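/- **Theorem 2 (Cut-elimination).** Formulas are given by $A ::= p \mid \bar p \mid A\wedge A \mid A\vee A \mid \Box A \mid \Diamond A$, where $p$ ranges over propositional variables; $\bar A$ denotes the negation of $A$, defined by de Morgan duality. A *nested sequent* is a finite multiset of formulas and of boxed sequents $[\Delta]$, where $\Delta$ is a nested sequent. A context $\Gamma\{\ \}$ is a nested sequent with one hole in place of a formula (possibly inside nested boxes, but not inside a formula), and $\Gamma\{\Delta\}$ is the result of putting the sequent $\Delta$ into the hole. The system $\mathsf{nK}$ has the rules $$\frac{}{\Gamma\{p,\bar p\}}\ \mathsf{id}\qquad \frac{\Gamma\{A,B\}}{\Gamma\{A\vee B\}}\ \vee\qquad \frac{\Gamma\{A\}\quad\Gamma\{B\}}{\Gamma\{A\wedge B\}}\ \wedge\qquad \frac{\Gamma\{[A]\}}{\Gamma\{\Box A\}}\ \Box\qquad \frac{\Gamma\{\Diamond A,[A,\Delta]\}}{\Gamma\{\Diamond A,[\Delta]\}}\ \Diamond$$ and, further, $$\frac{\Gamma\{A\}\quad\Gamma\{\bar A\}}{\Gamma\{\varnothing\}}\ \mathsf{cut}\qquad \frac{\Gamma\{\Diamond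 A,[\Delta_1,[\dots,[\Delta_{n-1},[A,\Delta_n]]\dots]]\}}{\Gamma\{\Diamond A,[\Delta_1,[\dots,[\Delta_{n-1},[\Delta_n]]\dots]]\}}\ \Diamond_{\mathsf{k}n}\quad(n\ge 1).$$ For $Y\subseteq\{n\in\mathbb N: n\ge 1\}$ put $\Diamond_{\mathsf{k}Y}=\{\Diamond_{\mathsf{k}n}: n\in Y\}$. A sequent is provable in a system if it is the root of a finite tree built from the rules of the system, all of whose leaves are instances of $\mathsf{id}$. Let $X\subseteq\{n\in\mathbb N: n>1\}$, and let $\hat X=\bigcup_{p\ge 0}X_p$ be its completion, where $X_0=X$ and $X_{p+1}=X_p\cup\{m+n-1: m,n\in X_p\}$. Let $\Gamma$ be a nested sequent. If $\Gamma$ is provable in $\mathsf{nK}+\Diamond_{\mathsf{k}\hat X}+\mathsf{cut}$, then $\Gamma$ is provable in $\mathsf{nK}+\Diamond_{\mathsf{k}\hat X}$. -/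

import Mathlib

namespace NestedModal

universe u

/-- Modal formulas in negation normal form over the propositional variables `α`. -/
inductive Formula (α : Type u) : Type u
  | atom (p : α)
  | natom (p : α)
  | and (A B : Formula α)
  | or (A B : Formula α)
  | box (A : Formula α)
  | dia (A : Formula α)

/-- Negation, by de Morgan duality. -/
def Formula.neg {α : Type u} : Formula α → Formula α
  | .atom p => .natom p
  | .natom p => .atom p
  | .and A B => .or A.neg B.neg
  | .or A B => .and A.neg B.neg
  | .box A => .dia A.neg
  | .dia A => .box A.neg

/-- Written nested sequents: `Γ ::= ∅ | A, Γ | [Δ], Γ`, where the order of writing still counts. -/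
inductive PreSeq (α : Type u) : Type u
  | nil
  | fml (A : Formula α) (Γ : PreSeq α)
  | brk (Δ Γ : PreSeq α)

namespace PreSeq

variable {α : Type u}

/-- Two written sequents denote the same multiset of formulas and boxed sequents: permutations of
the entries, at every level of nesting. -/
inductive Perm : PreSeq α → PreSeq α → Prop
  | nil : Perm .nil .nil
  | fml (A : Formula α) {Γ Γ' : PreSeq α} : Perm Γ Γ' → Perm (.fml A Γ) (.fml A Γ')
  | brk {Δ Δ' Γ Γ' : PreSeq α} : Perm Δ Δ' → Perm Γ Γ' → Perm (.brk Δ Γ) (.brk Δ' Γ')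
  | swap_fml_fml (A B : Formula α) (Γ : PreSeq α) :
      Perm (.fml A (.fml B Γ)) (.fml B (.fml A Γ))
  | swap_fml_brk (A : Formula α) (Δ Γ : PreSeq α) :
      Perm (.fml A (.brk Δ Γ)) (.brk Δ (.fml A Γ))
  | swap_brk_brk (Δ Θ Γ : PreSeq α) :
      Perm (.brk Δ (.brk Θ Γ)) (.brk Θ (.brk Δ Γ))
  | symm {Γ Δ : PreSeq α} : Perm Γ Δ → Perm Δ Γ
  | trans {Γ Δ Θ : PreSeq α} : Perm Γ Δ → Perm Δ Θ → Perm Γ Θ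

theorem Perm.refl : ∀ Γ : PreSeq α, Perm Γ Γ
  | .nil => .nil
  | .fml A Γ => .fml A (Perm.refl Γ)
  | .brk Δ Γ => .brk (Perm.refl Δ) (Perm.refl Γ)

instance setoid (α : Type u) : Setoid (PreSeq α) :=
  ⟨Perm, ⟨Perm.refl, Perm.symm, Perm.trans⟩⟩

/-- Juxtaposition `Γ, Δ`. -/
def append : PreSeq α → PreSeq α → PreSeq α
  | .nil, Δ => Δ
  | .fml A Γ, Δ => .fml A (append Γ Δ)
  | .brk Θ Γ, Δ => .brk Θ (append Γ Δ)

theorem append_right (Γ : PreSeq α) {Δ Δ' : PreSeq α} (h : Perm Δ Δ') :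
    Perm (append Γ Δ) (append Γ Δ') := by
  induction Γ with
  | nil => exact h
  | fml A Γ ih => exact .fml A ih
  | brk Θ Γ _ ih => exact .brk (.refl Θ) ih

theorem append_left {Γ Γ' : PreSeq α} (h : Perm Γ Γ') (Δ : PreSeq α) :
    Perm (append Γ Δ) (append Γ' Δ) := by
  induction h with
  | nil => exact .refl Δ
  | fml A _ ih => exact .fml A ih
  | brk h _ _ ih => exact .brk h ih
  | swap_fml_fml A B Γ => exact .swap_fml_fml A B _
  | swap_fml_brk A Θ Γ => exact .swap_fml_brk A Θ _
  | swap_brk_brk Θ Ξ Γ => exact .swap_brk_brk Θ Ξ _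
  | symm _ ih => exact .symm ih
  | trans _ _ ih₁ ih₂ => exact .trans ih₁ ih₂

end PreSeq

/-- Nested sequents: finite multisets of formulas and boxed nested sequents. -/
def NSeq (α : Type u) : Type u := Quotient (PreSeq.setoid α)

namespace NSeq

variable {α : Type u}

/-- The empty sequent. -/
instance : Zero (NSeq α) := ⟨Quotient.mk _ .nil⟩

/-- `Γ + Δ` is the sequent `Γ, Δ` (multiset union). -/
instance : Add (NSeq α) :=
  ⟨Quotient.map₂ PreSeq.append fun _ Γ' hΓ Δ _ hΔ =>
    (PreSeq.append_left hΓ Δ).trans (PreSeq.append_right Γ' hΔ)⟩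

/-- The sequent consisting of one formula. -/
def fml (A : Formula α) : NSeq α := Quotient.mk _ (.fml A .nil)

/-- The sequent `[Δ]` consisting of one boxed sequent. -/
def brk (Δ : NSeq α) : NSeq α :=
  Quotient.map (fun Δ => PreSeq.brk Δ .nil) (fun _ _ h => PreSeq.Perm.brk h .nil) Δ

/-- `nest [Δ₁, …, Δₙ] Θ` is `[Δ₁, [Δ₂, … [Δₙ, Θ] … ]]`. -/
def nest : List (NSeq α) → NSeq α → NSeq α
  | [], Θ => Θ
  | Δ :: L, Θ => brk (Δ + nest L Θ)

end NSeq

/-- Contexts with one hole: `Γ, { }` or `Γ, [C{ }]`. -/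
inductive Context (α : Type u) : Type u
  | hole (Γ : NSeq α)
  | brk (Γ : NSeq α) (C : Context α)

/-- `C.fill Δ` is `C{Δ}`, the hole replaced by the sequent `Δ`. -/
def Context.fill {α : Type u} : Context α → NSeq α → NSeq α
  | .hole Γ, Δ => Γ + Δ
  | .brk Γ C, Δ => Γ + NSeq.brk (C.fill Δ)

/-- A set of rule instances: `S premisses conclusion`. The sum of two systems is `⊔`. -/
abbrev System (α : Type u) := List (NSeq α) → NSeq α → Prop

open NSeq in
/-- The rules of `nK`. -/
inductive nK {α : Type u} : System α
  | id (C : Context α) (p : α) : nK [] (C.fill (fml (.atom p) + fml (.natom p)))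
  | or (C : Context α) (A B : Formula α) :
      nK [C.fill (fml A + fml B)] (C.fill (fml (.or A B)))
  | and (C : Context α) (A B : Formula α) :
      nK [C.fill (fml A), C.fill (fml B)] (C.fill (fml (.and A B)))
  | box (C : Context α) (A : Formula α) :
      nK [C.fill (brk (fml A))] (C.fill (fml (.box A)))
  | dia (C : Context α) (A : Formula α) (Δ : NSeq α) :
      nK [C.fill (fml (.dia A) + brk (fml A + Δ))] (C.fill (fml (.dia A) + brk Δ))

open NSeq in
/-- The cut rule. -/
inductive cut {α : Type u} : System α
  | mk (C : Context α) (A : Formula α) : cut [C.fill (fml A), C.fill (fml A.neg)] (C.fill 0)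

open NSeq in
/-- The propagation rules `◇_{kn}` for `n ∈ X`: from
`Γ{◇A, [Δ₁, [… [A, Δₙ] …]]}` infer `Γ{◇A, [Δ₁, [… [Δₙ] …]]}`. -/
inductive diaK {α : Type u} (X : Set ℕ) : System α
  | mk (C : Context α) (A : Formula α) (L : List (NSeq α)) (hL : L.length ∈ X) :
      diaK X [C.fill (fml (.dia A) + nest L (fml A))] (C.fill (fml (.dia A) + nest L 0))

/-- `S ⊢ Γ`: there is a finite proof tree with root `Γ` built from the rule instances of `S`. -/
inductive Provable {α : Type u} (S : System α) : NSeq α → Prop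
  | intro {ps : List (NSeq α)} {Γ : NSeq α} :
      S ps Γ → (∀ Δ ∈ ps, Provable S Δ) → Provable S Γ

/-- The stages of the completion: `X₀ = X`, `X_{p+1} = X_p ∪ {m + n - 1 : m, n ∈ X_p}`. -/
def completionStage (X : Set ℕ) : ℕ → Set ℕ
  | 0 => X
  | p + 1 => completionStage X p ∪
      {k | ∃ m ∈ completionStage X p, ∃ n ∈ completionStage X p, k = m + n - 1}

/-- The completion of `X`. -/
def completion (X : Set ℕ) : Set ℕ := ⋃ p, completionStage X p

end NestedModal

/-!
The proof is semantic: the system with cut is sound for a class of Kripke models, and the system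
without cut is complete for it.

*Soundness.* In a model where `n` successive steps of the accessibility relation `R`, for `n ∈ Y`,
always lie in `R`, all rules of `nK + ◇_{kY} + cut` preserve truth.

*Structural rules.* Weakening, contraction and the inversion of the rules for `∧`, `∨` and `□` are
all instances of upward closure of provability along one preorder on nested sequents, in which
`Γ, Δ` is the supremum of `Γ` and `Δ`; this closure is proved by a single induction.

*Completeness.* Consider trees, possibly infinite, whose nodes are labelled by sets of sequents, a
bracket `[Δ]` in a label giving rise to a child that is labelled by `Δ`. An unprovable sequent,
taken as the label of the root, extends to a tree that is maximal among those without a provable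
finite approximation. If `Δ` is missing from the label of a node, then by maximality some finite
approximation of the tree becomes provable once `Δ` is added at that node. So the rules, applied
to such approximations, saturate the labels. Let a node see its descendants at depth `1` and at
the depths `n ∈ Y`. By the propagation rules, every sequent then fails at the nodes that it labels.

*The role of the completion.* With `Y` closed under `(m, n) ↦ m + n - 1`, replacing one by one the
steps of an `n`-step path, `n ∈ Y`, by descents of depth in `Y ∪ {1}` keeps the total depth in
`Y ∪ {1}`, so that this model belongs to the class above.
-/

namespace NestedModal

universe u v

variable {α : Type u}

namespace PreSeq

theorem append_nil (Γ : PreSeq α) : append Γ .nil = Γ := by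
  induction Γ with
  | nil => rfl
  | fml A Γ ih => exact congrArg (fml A) ih
  | brk Δ Γ _ ih => exact congrArg (brk Δ) ih

theorem append_assoc (Γ Δ Θ : PreSeq α) :
    append (append Γ Δ) Θ = append Γ (append Δ Θ) := by
  induction Γ with
  | nil => rfl
  | fml A Γ ih => exact congrArg (fml A) ih
  | brk Ξ Γ _ ih => exact congrArg (brk Ξ) ih

theorem perm_append_fml (A : Formula α) (Γ Δ : PreSeq α) :
    Perm (append Γ (fml A Δ)) (fml A (append Γ Δ)) := by
  induction Γ with
  | nil => exact .refl _
  | fml B Γ ih => exact (Perm.fml B ih).trans (.swap_fml_fml B A _)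
  | brk Θ Γ _ ih => exact (Perm.brk (.refl Θ) ih).trans (.symm (.swap_fml_brk A Θ _))

theorem perm_append_brk (Θ Γ Δ : PreSeq α) :
    Perm (append Γ (brk Θ Δ)) (brk Θ (append Γ Δ)) := by
  induction Γ with
  | nil => exact .refl _
  | fml B Γ ih => exact (Perm.fml B ih).trans (.swap_fml_brk B Θ _)
  | brk Ξ Γ _ ih => exact (Perm.brk (.refl Ξ) ih).trans (.swap_brk_brk Ξ Θ _)

theorem perm_append_comm (Γ Δ : PreSeq α) : Perm (append Γ Δ) (append Δ Γ) := by
  induction Γ with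
  | nil => rw [append_nil]; exact .refl Δ
  | fml A Γ ih => exact (Perm.fml A ih).trans (perm_append_fml A Δ Γ).symm
  | brk Θ Γ _ ih => exact (Perm.brk (.refl Θ) ih).trans (perm_append_brk Θ Δ Γ).symm

section Fold

variable {M : Type v} [SemilatticeSup M] [OrderBot M] (f : Formula α → M) (g : M → M)

/-- The fold of a written sequent that sends juxtaposition to `⊔`, a formula `A` to `f A`, and
brackets to `g`. -/
def fold : PreSeq α → M
  | .nil => ⊥
  | .fml A Γ => f A ⊔ fold Γ
  | .brk Δ Γ => g (fold Δ) ⊔ fold Γ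

theorem fold_append (Γ Δ : PreSeq α) :
    fold f g (append Γ Δ) = fold f g Γ ⊔ fold f g Δ := by
  induction Γ with
  | nil => exact (bot_sup_eq _).symm
  | fml A Γ ih => simp only [append, fold, ih, sup_assoc]
  | brk Θ Γ _ ih => simp only [append, fold, ih, sup_assoc]

theorem Perm.fold_eq {Γ Δ : PreSeq α} (h : Perm Γ Δ) : fold f g Γ = fold f g Δ := by
  induction h with
  | nil => rfl
  | fml A _ ih => simp only [fold, ih]
  | brk _ _ ihΔ ihΓ => simp only [fold, ihΔ, ihΓ]
  | swap_fml_fml | swap_fml_brk | swap_brk_brk => exact sup_left_comm _ _ _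
  | symm _ ih => exact ih.symm
  | trans _ _ ih₁ ih₂ => exact ih₁.trans ih₂

end Fold

end PreSeq

namespace NSeq

instance : AddCommMonoid (NSeq α) where
  add_assoc := by
    rintro ⟨Γ⟩ ⟨Δ⟩ ⟨Θ⟩
    exact congrArg (Quotient.mk _) (PreSeq.append_assoc Γ Δ Θ)
  zero_add := by
    rintro ⟨Γ⟩
    rfl
  add_zero := by
    rintro ⟨Γ⟩
    exact congrArg (Quotient.mk _) (PreSeq.append_nil Γ)
  add_comm := by
    rintro ⟨Γ⟩ ⟨Δ⟩
    exact Quotient.sound (PreSeq.perm_append_comm Γ Δ)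
  nsmul := nsmulRec

@[elab_as_elim]
theorem induction {P : NSeq α → Prop} (zero : P 0) (fml : ∀ A, P (fml A))
    (brk : ∀ Δ, P Δ → P (brk Δ)) (add : ∀ Γ Δ, P Γ → P Δ → P (Γ + Δ)) (Γ : NSeq α) : P Γ := by
  obtain ⟨Γ⟩ := Γ
  induction Γ with
  | nil => exact zero
  | fml A Γ ih => exact add (.fml A) _ (fml A) ih
  | brk Δ Γ ihΔ ihΓ => exact add (.brk (Quotient.mk _ Δ)) _ (brk _ ihΔ) ihΓ

section Lift

variable {M : Type v} [SemilatticeSup M] [OrderBot M] (f : Formula α → M) (g : M → M)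

/-- The map on nested sequents that sends multiset union to `⊔`, a formula `A` to `f A`, and
brackets to `g`. It serves to define predicates on nested sequents by recursion. -/
def lift : NSeq α → M :=
  Quotient.lift (PreSeq.fold f g) fun _ _ h => PreSeq.Perm.fold_eq f g h

theorem lift_zero : lift f g 0 = ⊥ := rfl

theorem lift_fml (A : Formula α) : lift f g (fml A) = f A := sup_bot_eq _

theorem lift_brk (Δ : NSeq α) : lift f g (brk Δ) = g (lift f g Δ) := by
  obtain ⟨Δ⟩ := Δ
  exact sup_bot_eq _

theorem lift_add (Γ Δ : NSeq α) : lift f g (Γ + Δ) = lift f g Γ ⊔ lift f g Δ := by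
  obtain ⟨Γ⟩ := Γ
  obtain ⟨Δ⟩ := Δ
  exact PreSeq.fold_append f g Γ Δ

end Lift

/-- The set of the formulas outside all brackets. -/
def formulas (Γ : NSeq α) : Set (Formula α) := lift singleton (fun _ => ∅) Γ

theorem formulas_zero : (0 : NSeq α).formulas = ∅ := lift_zero _ _

theorem formulas_fml (A : Formula α) : (fml A).formulas = {A} := lift_fml _ _ A

theorem formulas_brk (Δ : NSeq α) : (brk Δ).formulas = ∅ := lift_brk _ _ Δ

theorem formulas_add (Γ Δ : NSeq α) : (Γ + Δ).formulas = Γ.formulas ∪ Δ.formulas :=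
  lift_add _ _ Γ Δ

theorem formulas_nest_zero (L : List (NSeq α)) : (nest L 0).formulas = ∅ := by
  cases L with
  | nil => exact formulas_zero
  | cons Δ L => exact formulas_brk _

theorem exists_eq_fml_add {A : Formula α} {Γ : NSeq α} (h : A ∈ Γ.formulas) :
    ∃ Δ, Γ = fml A + Δ := by
  induction Γ using NSeq.induction with
  | zero => simp only [formulas_zero, Set.mem_empty_iff_false] at h
  | fml B =>
    rw [formulas_fml, Set.mem_singleton_iff] at h
    exact ⟨0, by rw [h, add_zero]⟩
  | brk Δ _ => simp only [formulas_brk, Set.mem_empty_iff_false] at h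
  | add Γ Δ ihΓ ihΔ =>
    rw [formulas_add] at h
    rcases h with h | h
    · obtain ⟨Θ, rfl⟩ := ihΓ h
      exact ⟨Θ + Δ, add_assoc _ _ _⟩
    · obtain ⟨Θ, rfl⟩ := ihΔ h
      exact ⟨Γ + Θ, add_left_comm _ _ _⟩

end NSeq

/-! ### The structural order -/

/-- `A.Covered Θ`: what is left of `A` in the sequent `Θ` after some applications, from conclusion
to premiss, of the rules for `∧`, `∨` and `□`. -/
def Formula.Covered : Formula α → NSeq α → Prop
  | .atom p, Θ => .atom p ∈ Θ.formulas
  | .natom p, Θ => .natom p ∈ Θ.formulas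
  | .and A B, Θ => .and A B ∈ Θ.formulas ∨ A.Covered Θ ∨ B.Covered Θ
  | .or A B, Θ => .or A B ∈ Θ.formulas ∨ A.Covered Θ ∧ B.Covered Θ
  | .box A, Θ => .box A ∈ Θ.formulas ∨ ∃ Δ Ξ, Θ = .brk Δ + Ξ ∧ A.Covered Δ
  | .dia A, Θ => .dia A ∈ Θ.formulas

namespace NSeq

theorem covered_of_mem_formulas {A : Formula α} {Θ : NSeq α} (h : A ∈ Θ.formulas) :
    A.Covered Θ := by
  cases A with
  | atom | natom | dia => exact h
  | and | or | box => exact .inl h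

/-- The sequents above `Γ` in the structural order. They form an element of the order dual of
`Set (NSeq α)` because `Γ + Δ` is to become the supremum of `Γ` and `Δ`. -/
def upper (Γ : NSeq α) : (Set (NSeq α))ᵒᵈ :=
  lift (fun A => OrderDual.toDual {Θ | A.Covered Θ})
    (fun s => OrderDual.toDual {Θ | ∃ Δ Ξ, Θ = brk Δ + Ξ ∧ Δ ∈ OrderDual.ofDual s}) Γ

/-- The structural order: `Γ ≤ Θ` if there is a map from the nodes of the tree `Γ` to those of `Θ`
that preserves the root and the edges, such that every formula of `Γ` is covered at its image. The
map need not be injective, so that `Γ + Γ ≤ Γ`; this is only a preorder, with `+` as supremum. -/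
instance : LE (NSeq α) where
  le Γ Θ := Θ ∈ OrderDual.ofDual Γ.upper

protected theorem zero_le (Θ : NSeq α) : 0 ≤ Θ := trivial

theorem fml_le_iff {A : Formula α} {Θ : NSeq α} : fml A ≤ Θ ↔ A.Covered Θ :=
  iff_of_eq (congrArg (Θ ∈ OrderDual.ofDual ·) (lift_fml _ _ A))

theorem brk_le_iff {Δ Θ : NSeq α} : brk Δ ≤ Θ ↔ ∃ Δ' Ξ, Θ = brk Δ' + Ξ ∧ Δ ≤ Δ' :=
  iff_of_eq (congrArg (Θ ∈ OrderDual.ofDual ·) (lift_brk _ _ Δ))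

theorem add_le_iff {Γ Δ Θ : NSeq α} : Γ + Δ ≤ Θ ↔ Γ ≤ Θ ∧ Δ ≤ Θ :=
  iff_of_eq (congrArg (Θ ∈ OrderDual.ofDual ·) (lift_add _ _ Γ Δ))

theorem le_self_add (Γ Δ : NSeq α) : Γ ≤ Γ + Δ := by
  induction Γ using NSeq.induction generalizing Δ with
  | zero => exact NSeq.zero_le _
  | fml A =>
    refine fml_le_iff.2 (covered_of_mem_formulas ?_)
    rw [formulas_add, formulas_fml]
    exact .inl rfl
  | brk Γ ih => exact brk_le_iff.2 ⟨Γ, Δ, rfl, by simpa only [add_zero] using ih 0⟩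
  | add Γ Γ' ih ih' =>
    refine add_le_iff.2 ⟨?_, ?_⟩
    · rw [add_assoc]
      exact ih _
    · rw [add_comm Γ, add_assoc]
      exact ih' _

theorem fml_le_of_mem_formulas {A : Formula α} {Γ Θ : NSeq α} (hA : A ∈ Γ.formulas) (h : Γ ≤ Θ) :
    fml A ≤ Θ := by
  obtain ⟨Δ, rfl⟩ := exists_eq_fml_add hA
  exact (add_le_iff.1 h).1

end NSeq

open NSeq in
theorem Formula.Covered.trans_le {A : Formula α} {Γ Θ : NSeq α}
    (hA : A.Covered Γ) (h : Γ ≤ Θ) : A.Covered Θ := by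
  induction A generalizing Γ Θ with
  | atom | natom | dia => exact fml_le_iff.1 (fml_le_of_mem_formulas hA h)
  | and A B ihA ihB =>
    rcases hA with hm | hA | hB
    · exact fml_le_iff.1 (fml_le_of_mem_formulas hm h)
    · exact .inr (.inl (ihA hA h))
    · exact .inr (.inr (ihB hB h))
  | or A B ihA ihB =>
    rcases hA with hm | ⟨hA, hB⟩
    · exact fml_le_iff.1 (fml_le_of_mem_formulas hm h)
    · exact .inr ⟨ihA hA h, ihB hB h⟩
  | box A ih =>
    rcases hA with hm | ⟨Δ, Ξ, rfl, hA⟩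
    · exact fml_le_iff.1 (fml_le_of_mem_formulas hm h)
    · obtain ⟨Δ', Ξ', rfl, hΔ⟩ := brk_le_iff.1 (add_le_iff.1 h).1
      exact .inr ⟨Δ', Ξ', rfl, ih hA hΔ⟩

namespace NSeq

instance : Preorder (NSeq α) where
  le_refl Γ := by simpa only [add_zero] using le_self_add Γ 0
  le_trans Γ Δ Θ h h' := by
    induction Γ using NSeq.induction generalizing Δ Θ with
    | zero => exact NSeq.zero_le Θ
    | fml A => exact fml_le_iff.2 ((fml_le_iff.1 h).trans_le h')
    | brk Γ ih =>
      obtain ⟨Δ₁, Ξ, rfl, hΔ⟩ := brk_le_iff.1 h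
      obtain ⟨Θ₁, Ξ', rfl, hΘ⟩ := brk_le_iff.1 (add_le_iff.1 h').1
      exact brk_le_iff.2 ⟨Θ₁, Ξ', rfl, ih _ _ hΔ hΘ⟩
    | add Γ Γ' ih ih' =>
      obtain ⟨h₁, h₂⟩ := add_le_iff.1 h
      exact add_le_iff.2 ⟨ih _ _ h₁ h', ih' _ _ h₂ h'⟩

theorem le_add_self (Γ Δ : NSeq α) : Γ ≤ Δ + Γ := add_comm Γ Δ ▸ le_self_add Γ Δ

instance : AddLeftMono (NSeq α) where
  elim Γ _ Δ' h := add_le_iff.2 ⟨le_self_add Γ Δ', h.trans (le_add_self Δ' Γ)⟩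

@[gcongr]
theorem brk_mono {Δ Δ' : NSeq α} (h : Δ ≤ Δ') : brk Δ ≤ brk Δ' :=
  brk_le_iff.2 ⟨Δ', 0, (add_zero _).symm, h⟩

@[gcongr]
theorem nest_mono {Δ Δ' : NSeq α} (L : List (NSeq α)) (h : Δ ≤ Δ') : nest L Δ ≤ nest L Δ' := by
  induction L with
  | nil => exact h
  | cons Θ L ih => exact brk_mono (add_le_add_right ih Θ)

theorem fml_and_le_left (A B : Formula α) : fml (.and A B) ≤ fml A :=
  fml_le_iff.2 (.inr (.inl (fml_le_iff.1 le_rfl)))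

theorem fml_and_le_right (A B : Formula α) : fml (.and A B) ≤ fml B :=
  fml_le_iff.2 (.inr (.inr (fml_le_iff.1 le_rfl)))

theorem fml_or_le (A B : Formula α) : fml (.or A B) ≤ fml A + fml B :=
  fml_le_iff.2 (.inr ⟨fml_le_iff.1 (le_self_add _ _), fml_le_iff.1 (le_add_self _ _)⟩)

theorem fml_box_le (A : Formula α) : fml (.box A) ≤ brk (fml A) :=
  fml_le_iff.2 (.inr ⟨fml A, 0, (add_zero _).symm, fml_le_iff.1 le_rfl⟩)

theorem exists_nest_of_nest_zero_le {L : List (NSeq α)} {Θ : NSeq α} (h : nest L 0 ≤ Θ) :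
    ∃ L' Ξ, L'.length = L.length ∧ Θ = nest L' 0 + Ξ ∧ ∀ Ψ, nest L Ψ ≤ nest L' Ψ := by
  induction L generalizing Θ with
  | nil => exact ⟨[], Θ, rfl, (zero_add Θ).symm, fun _ => le_rfl⟩
  | cons Δ L ih =>
    obtain ⟨Δ', Ξ, rfl, hΔL⟩ := brk_le_iff.1 h
    obtain ⟨hΔ, hL⟩ := add_le_iff.1 hΔL
    obtain ⟨L', Ξ', hlen, rfl, hL'⟩ := ih hL
    refine ⟨Ξ' :: L', Ξ, congrArg (· + 1) hlen, by rw [nest, add_comm Ξ'], fun Ψ => brk_mono ?_⟩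
    refine add_le_iff.2 ⟨?_, (hL' Ψ).trans (le_add_self _ _)⟩
    calc Δ ≤ nest L' 0 + Ξ' := hΔ
      _ ≤ nest L' Ψ + Ξ' := by gcongr; exact NSeq.zero_le Ψ
      _ = Ξ' + nest L' Ψ := add_comm _ _

end NSeq

/-! ### Contexts and admissible rules -/

namespace Context

/-- The context obtained from `C` by adding the sequent `Ξ` next to the hole. -/
def add : Context α → NSeq α → Context α
  | hole Γ, Ξ => hole (Γ + Ξ)
  | brk Γ C, Ξ => brk Γ (C.add Ξ)

theorem fill_add (C : Context α) (Ξ Δ : NSeq α) : (C.add Ξ).fill Δ = C.fill (Δ + Ξ) := by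
  induction C with
  | hole Γ => exact (add_assoc Γ Ξ Δ).trans (congrArg (Γ + ·) (add_comm Ξ Δ))
  | brk Γ C ih => exact congrArg (Γ + NSeq.brk ·) ih

@[gcongr]
theorem fill_mono (C : Context α) {Δ Δ' : NSeq α} (h : Δ ≤ Δ') : C.fill Δ ≤ C.fill Δ' := by
  induction C with
  | hole Γ => exact add_le_add_right h Γ
  | brk Γ C ih => exact add_le_add_right (NSeq.brk_mono ih) Γ

theorem exists_fill_of_fill_le {C : Context α} {Δ Θ : NSeq α} (h : C.fill Δ ≤ Θ) :
    ∃ C' Θ', Θ = fill C' Θ' ∧ Δ ≤ Θ' ∧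
      ∀ ⦃Ξ⦄, Θ' ≤ Ξ → ∀ ⦃Ψ⦄, Ψ ≤ Ξ → C.fill Ψ ≤ C'.fill Ξ := by
  induction C generalizing Θ with
  | hole Γ =>
    obtain ⟨hΓ, hΔ⟩ := NSeq.add_le_iff.1 h
    refine ⟨hole 0, Θ, (zero_add Θ).symm, hΔ, fun Ξ hΞ Ψ hΨ => ?_⟩
    exact (NSeq.add_le_iff.2 ⟨hΓ.trans hΞ, hΨ⟩).trans_eq (zero_add Ξ).symm
  | brk Γ C ih =>
    obtain ⟨hΓ, hC⟩ := NSeq.add_le_iff.1 h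
    obtain ⟨Θ₁, Γ', rfl, hΘ₁⟩ := NSeq.brk_le_iff.1 hC
    obtain ⟨C', Θ', rfl, hΔ, hC'⟩ := ih hΘ₁
    refine ⟨brk Γ' C', Θ', add_comm _ _, hΔ, fun Ξ hΞ Ψ hΨ => NSeq.add_le_iff.2 ⟨?_, ?_⟩⟩
    · calc Γ ≤ NSeq.brk (C'.fill Θ') + Γ' := hΓ
        _ ≤ NSeq.brk (C'.fill Ξ) + Γ' := by gcongr
        _ = Γ' + NSeq.brk (C'.fill Ξ) := add_comm _ _
    · exact (NSeq.brk_mono (hC' hΞ hΨ)).trans (NSeq.le_add_self _ _)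

end Context

namespace Provable

open NSeq

variable {Y : Set ℕ} {C : Context α} {A B : Formula α} {Γ Θ : NSeq α}

theorem or_rule (h : Provable (nK ⊔ diaK Y) (C.fill (fml A + fml B))) :
    Provable (nK ⊔ diaK Y) (C.fill (fml (.or A B))) :=
  .intro (.inl (.or C A B)) (List.forall_mem_singleton.2 h)

theorem and_rule (hA : Provable (nK ⊔ diaK Y) (C.fill (fml A)))
    (hB : Provable (nK ⊔ diaK Y) (C.fill (fml B))) :
    Provable (nK ⊔ diaK Y) (C.fill (fml (.and A B))) :=
  .intro (.inl (.and C A B)) (List.forall_mem_cons.2 ⟨hA, List.forall_mem_singleton.2 hB⟩)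

theorem box_rule (h : Provable (nK ⊔ diaK Y) (C.fill (brk (fml A)))) :
    Provable (nK ⊔ diaK Y) (C.fill (fml (.box A))) :=
  .intro (.inl (.box C A)) (List.forall_mem_singleton.2 h)

-- The rule `◇` of `nK` is the missing instance `n = 1` of the propagation rule.
theorem dia_rule {L : List (NSeq α)} (hL : L.length ∈ insert 1 Y)
    (h : Provable (nK ⊔ diaK Y) (C.fill (fml (.dia A) + nest L (fml A)))) :
    Provable (nK ⊔ diaK Y) (C.fill (fml (.dia A) + nest L 0)) := by
  rcases hL with hL | hL
  · obtain ⟨Δ, rfl⟩ := List.length_eq_one_iff.1 hL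
    rw [nest, nest, add_comm Δ] at h
    rw [nest, nest, add_zero]
    exact .intro (.inl (.dia C A Δ)) (List.forall_mem_singleton.2 h)
  · exact .intro (.inr (.mk C A L hL)) (List.forall_mem_singleton.2 h)

theorem fill_of_atom_le {p : α} (h : fml (.atom p) + fml (.natom p) ≤ Θ) :
    Provable (nK ⊔ diaK Y) (C.fill Θ) := by
  obtain ⟨hp, hn⟩ := add_le_iff.1 h
  obtain ⟨Ξ, rfl⟩ := exists_eq_fml_add (fml_le_iff.1 hp)
  have hn' : Formula.natom p ∈ (fml (.atom p) + Ξ).formulas := fml_le_iff.1 hn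
  rw [formulas_add, formulas_fml] at hn'
  obtain ⟨Ψ, rfl⟩ := exists_eq_fml_add (hn'.resolve_left nofun)
  rw [← add_assoc, ← Context.fill_add]
  exact .intro (.inl (.id _ p)) nofun

theorem fill_of_or_le (h : fml (.or A B) ≤ Θ)
    (hprem : ∀ Ξ, Θ ≤ Ξ → fml A + fml B ≤ Ξ → Provable (nK ⊔ diaK Y) (C.fill Ξ)) :
    Provable (nK ⊔ diaK Y) (C.fill Θ) := by
  rcases fml_le_iff.1 h with hm | ⟨hA, hB⟩
  · obtain ⟨Ξ, rfl⟩ := exists_eq_fml_add hm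
    rw [← Context.fill_add]
    refine or_rule ?_
    rw [Context.fill_add]
    exact hprem _ (by gcongr; exact fml_or_le A B) (le_self_add _ _)
  · exact hprem Θ le_rfl (add_le_iff.2 ⟨fml_le_iff.2 hA, fml_le_iff.2 hB⟩)

theorem fill_of_and_le (h : fml (.and A B) ≤ Θ)
    (hA : ∀ Ξ, Θ ≤ Ξ → fml A ≤ Ξ → Provable (nK ⊔ diaK Y) (C.fill Ξ))
    (hB : ∀ Ξ, Θ ≤ Ξ → fml B ≤ Ξ → Provable (nK ⊔ diaK Y) (C.fill Ξ)) :
    Provable (nK ⊔ diaK Y) (C.fill Θ) := by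
  rcases fml_le_iff.1 h with hm | hcA | hcB
  · obtain ⟨Ξ, rfl⟩ := exists_eq_fml_add hm
    rw [← Context.fill_add]
    apply and_rule <;> rw [Context.fill_add]
    · exact hA _ (by gcongr; exact fml_and_le_left A B) (le_self_add _ _)
    · exact hB _ (by gcongr; exact fml_and_le_right A B) (le_self_add _ _)
  · exact hA Θ le_rfl (fml_le_iff.2 hcA)
  · exact hB Θ le_rfl (fml_le_iff.2 hcB)

theorem fill_of_box_le (h : fml (.box A) ≤ Θ)
    (hprem : ∀ Ξ, Θ ≤ Ξ → brk (fml A) ≤ Ξ → Provable (nK ⊔ diaK Y) (C.fill Ξ)) :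
    Provable (nK ⊔ diaK Y) (C.fill Θ) := by
  rcases fml_le_iff.1 h with hm | ⟨Δ, Ξ, rfl, hA⟩
  · obtain ⟨Ξ, rfl⟩ := exists_eq_fml_add hm
    rw [← Context.fill_add]
    refine box_rule ?_
    rw [Context.fill_add]
    exact hprem _ (by gcongr; exact fml_box_le A) (le_self_add _ _)
  · exact hprem _ le_rfl (brk_le_iff.2 ⟨Δ, Ξ, rfl, fml_le_iff.2 hA⟩)

theorem fill_of_dia_le {L : List (NSeq α)} (hL : L.length ∈ insert 1 Y)
    (h : fml (.dia A) + nest L 0 ≤ Θ)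
    (hprem : ∀ Ξ, Θ ≤ Ξ → fml (.dia A) + nest L (fml A) ≤ Ξ →
      Provable (nK ⊔ diaK Y) (C.fill Ξ)) :
    Provable (nK ⊔ diaK Y) (C.fill Θ) := by
  obtain ⟨hA, hnest⟩ := add_le_iff.1 h
  obtain ⟨L', Ξ, hlen, rfl, hL'⟩ := exists_nest_of_nest_zero_le hnest
  have hm : Formula.dia A ∈ (nest L' 0 + Ξ).formulas := fml_le_iff.1 hA
  rw [formulas_add, formulas_nest_zero, Set.empty_union] at hm
  obtain ⟨Ψ, rfl⟩ := exists_eq_fml_add hm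
  rw [add_left_comm, ← add_assoc, ← Context.fill_add]
  refine dia_rule (hlen ▸ hL) ?_
  rw [Context.fill_add]
  refine hprem _ ?_ ?_
  · rw [add_left_comm, ← add_assoc]
    gcongr
    exact NSeq.zero_le _
  · calc fml (.dia A) + nest L (fml A) ≤ fml (.dia A) + nest L' (fml A) := by
          gcongr; exact hL' _
      _ ≤ fml (.dia A) + nest L' (fml A) + Ψ := le_self_add _ _

/-- Weakening, contraction, and the inversion of the rules for `∧`, `∨` and `□` are admissible. -/
theorem of_le (h : Provable (nK ⊔ diaK Y) Γ) (hle : Γ ≤ Θ) : Provable (nK ⊔ diaK Y) Θ := by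
  induction h generalizing Θ with
  | intro hr _ ih =>
    rcases hr with (⟨C, p⟩ | ⟨C, A, B⟩ | ⟨C, A, B⟩ | ⟨C, A⟩ | ⟨C, A, Δ⟩) | ⟨C, A, L, hL⟩ <;>
      obtain ⟨C', Θ, rfl, hΔ, hC'⟩ := Context.exists_fill_of_fill_le hle
    · exact fill_of_atom_le hΔ
    · exact fill_of_or_le hΔ fun _ hΞ h => ih _ (.head _) (hC' hΞ h)
    · exact fill_of_and_le hΔ (fun _ hΞ h => ih _ (.head _) (hC' hΞ h))
        fun _ hΞ h => ih _ (.tail _ (.head _)) (hC' hΞ h)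
    · exact fill_of_box_le hΔ fun _ hΞ h => ih _ (.head _) (hC' hΞ h)
    · refine fill_of_dia_le (L := [Δ]) (.inl rfl) (by rwa [nest, nest, add_zero])
        fun _ hΞ h => ih _ (.head _) (hC' hΞ ?_)
      rwa [nest, nest, add_comm Δ] at h
    · exact fill_of_dia_le (.inr hL) hΔ fun _ hΞ h => ih _ (.head _) (hC' hΞ h)

end Provable

/-! ### Kripke semantics -/

/-- Kripke models with the set of worlds `W`. -/
structure Model (α : Type u) (W : Type v) where
  rel : W → W → Prop
  val : W → α → Prop

section Semantics

variable {W : Type v} (M : Model α W)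

/-- `M.Reach n x y`: the world `y` is reached from `x` in `n` steps. -/
def Model.Reach : ℕ → W → W → Prop
  | 0, x, y => x = y
  | n + 1, x, y => ∃ z, M.rel x z ∧ Reach n z y

/-- Satisfaction of a formula at a world. -/
def Formula.Sat : Formula α → W → Prop
  | atom p, x => M.val x p
  | natom p, x => ¬M.val x p
  | and A B, x => A.Sat x ∧ B.Sat x
  | or A B, x => A.Sat x ∨ B.Sat x
  | box A, x => ∀ y, M.rel x y → A.Sat y
  | dia A, x => ∃ y, M.rel x y ∧ A.Sat y

variable {M} {x : W}

theorem Formula.sat_neg {A : Formula α} : A.neg.Sat M x ↔ ¬A.Sat M x := by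
  induction A generalizing x with
  | atom p => rfl
  | natom p => exact not_not.symm
  | and A B ihA ihB => simp only [neg, Sat, ihA, ihB, not_and_or]
  | or A B ihA ihB => simp only [neg, Sat, ihA, ihB, not_or]
  | box A ih => simp only [neg, Sat, ih, not_forall, exists_prop]
  | dia A ih => simp only [neg, Sat, ih, not_exists, not_and]

namespace NSeq

variable (M) in
/-- Satisfaction of a nested sequent at a world: the comma is read as a disjunction and brackets
are read as `□`. -/
def Sat (Γ : NSeq α) : W → Prop := lift (·.Sat M) (fun s x => ∀ y, M.rel x y → s y) Γ

theorem not_sat_zero : ¬(0 : NSeq α).Sat M x := id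

theorem sat_fml {A : Formula α} : (fml A).Sat M x ↔ A.Sat M x :=
  iff_of_eq (congrFun (lift_fml _ _ A) x)

theorem sat_brk {Δ : NSeq α} : (brk Δ).Sat M x ↔ ∀ y, M.rel x y → Δ.Sat M y :=
  iff_of_eq (congrFun (lift_brk _ _ Δ) x)

theorem sat_add {Γ Δ : NSeq α} : (Γ + Δ).Sat M x ↔ Γ.Sat M x ∨ Δ.Sat M x :=
  iff_of_eq (congrFun (lift_add _ _ Γ Δ) x)

theorem Sat.of_nest {L : List (NSeq α)} {Θ : NSeq α} (h : (nest L Θ).Sat M x) :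
    (nest L 0).Sat M x ∨ ∃ y, M.Reach L.length x y ∧ Θ.Sat M y := by
  induction L generalizing x with
  | nil => exact .inr ⟨x, rfl, h⟩
  | cons Δ L ih =>
    refine or_iff_not_imp_right.2 fun hΘ => sat_brk.2 fun y hxy => sat_add.2 ?_
    refine (sat_add.1 (sat_brk.1 h y hxy)).imp_right fun hy => (ih hy).resolve_right ?_
    rintro ⟨z, hyz, hz⟩
    exact hΘ ⟨z, ⟨y, hxy, hyz⟩, hz⟩

theorem Sat.of_dia_add_nest {A : Formula α} {L : List (NSeq α)}
    (hM : ∀ ⦃x y⦄, M.Reach L.length x y → M.rel x y)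
    (h : (fml (.dia A) + nest L (fml A)).Sat M x) :
    (fml (.dia A) + nest L 0).Sat M x := by
  rcases sat_add.1 h with hA | hA
  · exact sat_add.2 (.inl hA)
  · rcases hA.of_nest with h0 | ⟨y, hxy, hy⟩
    · exact sat_add.2 (.inr h0)
    · exact sat_add.2 (.inl (sat_fml.2 ⟨y, hM hxy, sat_fml.1 hy⟩))

theorem sat_fill_of_forall {ps : List (NSeq α)} {Θ : NSeq α} (C : Context α)
    (hΘ : ∀ y, (∀ Δ ∈ ps, Δ.Sat M y) → Θ.Sat M y)
    (h : ∀ Δ ∈ ps.map C.fill, Δ.Sat M x) : (C.fill Θ).Sat M x := by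
  rw [List.forall_mem_map] at h
  induction C generalizing x with
  | hole Γ =>
    refine sat_add.2 (or_iff_not_imp_left.2 fun hΓ => hΘ x fun Δ hΔ => ?_)
    exact (sat_add.1 (h Δ hΔ)).resolve_left hΓ
  | brk Γ C ih =>
    refine sat_add.2 (or_iff_not_imp_left.2 fun hΓ => sat_brk.2 fun y hxy => ih fun Δ hΔ => ?_)
    exact sat_brk.1 ((sat_add.1 (h Δ hΔ)).resolve_left hΓ) y hxy

end NSeq

variable {ps : List (NSeq α)} {Γ : NSeq α}

open NSeq

theorem nK.sat (h : nK ps Γ) (hps : ∀ Δ ∈ ps, Δ.Sat M x) : Γ.Sat M x := by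
  cases h with
  | id C p =>
    refine sat_fill_of_forall (ps := []) C (fun y _ => ?_) hps
    simpa only [sat_add, sat_fml, Formula.Sat] using em (M.val y p)
  | or C A B =>
    refine sat_fill_of_forall (ps := [_]) C (fun y hy => ?_) hps
    simpa only [List.forall_mem_singleton, sat_add, sat_fml, Formula.Sat] using hy
  | and C A B =>
    refine sat_fill_of_forall (ps := [fml A, fml B]) C (fun y hy => sat_fml.2 ⟨?_, ?_⟩) hps
    · exact sat_fml.1 (hy _ (.head _))
    · exact sat_fml.1 (hy _ (.tail _ (.head _)))
  | box C A =>
    refine sat_fill_of_forall (ps := [_]) C (fun y hy => ?_) hps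
    simpa only [List.forall_mem_singleton, sat_brk, sat_fml, Formula.Sat] using hy
  | dia C A Δ =>
    have hrel : ∀ ⦃x z⦄, M.Reach 1 x z → M.rel x z := by
      rintro x z ⟨_, hxz, rfl⟩
      exact hxz
    refine sat_fill_of_forall (ps := [_]) C (fun y hy => ?_) hps
    have hy' : (fml (.dia A) + nest [Δ] (fml A)).Sat M y := by
      simpa only [nest, add_comm Δ] using hy _ (.head _)
    simpa only [nest, add_zero] using hy'.of_dia_add_nest hrel

theorem diaK.sat {Y : Set ℕ} (hM : ∀ n ∈ Y, ∀ ⦃x y⦄, M.Reach n x y → M.rel x y)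
    (h : diaK Y ps Γ) (hps : ∀ Δ ∈ ps, Δ.Sat M x) : Γ.Sat M x := by
  obtain ⟨C, A, L, hL⟩ := h
  exact sat_fill_of_forall (ps := [_]) C
    (fun y hy => (hy _ (.head _)).of_dia_add_nest (hM _ hL)) hps

theorem cut.sat (h : cut ps Γ) (hps : ∀ Δ ∈ ps, Δ.Sat M x) : Γ.Sat M x := by
  obtain ⟨C, A⟩ := h
  refine sat_fill_of_forall (ps := [fml A, fml A.neg]) C (fun y hy => ?_) hps
  have hA : A.Sat M y := sat_fml.1 (hy _ (.head _))
  have hAneg : A.neg.Sat M y := sat_fml.1 (hy _ (.tail _ (.head _)))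
  exact absurd hA (Formula.sat_neg.1 hAneg)

theorem Provable.sat {Y : Set ℕ} (hM : ∀ n ∈ Y, ∀ ⦃x y⦄, M.Reach n x y → M.rel x y)
    (h : Provable (nK ⊔ diaK Y ⊔ cut) Γ) (x : W) : Γ.Sat M x := by
  induction h with
  | intro hr _ ih =>
    rcases hr with (hr | hr) | hr
    · exact hr.sat ih
    · exact hr.sat hM ih
    · exact hr.sat ih

end Semantics

/-! ### Labelled trees -/

/-- Labelled trees: `(l, Γ) ∈ S` says that the sequent `Γ` belongs to the label of the node `l`. A
node is given by its path from the root, the list of the sequents in the brackets `[Δ]` that the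
edges of the path stand for. -/
abbrev Labelling (α : Type u) := Set (List (NSeq α) × NSeq α)

namespace Labelling

open NSeq

variable {S T : Labelling α} {l : List (NSeq α)} {C : Context α} {s t Γ Δ Θ : NSeq α}

/-- The subtree at the child of the root that the bracket `[s]` stands for. The sequent `s` belongs
to the label of its root whether or not this is recorded in `S`. -/
def child (S : Labelling α) (s : NSeq α) : Labelling α :=
  insert ([], s) {i | (s :: i.1, i.2) ∈ S}

/-- The subtree at the node `l`. -/
def subtree (S : Labelling α) (l : List (NSeq α)) : Labelling α := l.foldl child S

/-- The label of the node `l`. -/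
def label (S : Labelling α) (l : List (NSeq α)) : Set (NSeq α) := {Γ | ([], Γ) ∈ S.subtree l}

/-- The path `l` leads to a node: each edge stands for a bracket in the label it starts from. -/
def IsNode : Labelling α → List (NSeq α) → Prop
  | _, [] => True
  | S, s :: l => ([], brk s) ∈ S ∧ IsNode (S.child s) l

/-- Only nodes have labels. -/
def Rooted (S : Labelling α) : Prop := ∀ i ∈ S, S.IsNode i.1

theorem child_mono (h : S ⊆ T) (s : NSeq α) : S.child s ⊆ T.child s :=
  Set.insert_subset_insert fun _ hi => h hi

theorem child_insert_cons_self : child (insert (s :: l, Δ) S) s = insert (l, Δ) (S.child s) := by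
  ext ⟨l', Γ⟩
  simp only [child, Set.mem_insert_iff, Set.mem_ofPred_eq, Prod.mk.injEq, List.cons.injEq, true_and]
  exact or_left_comm

theorem child_insert_of_forall_ne (h : ∀ l', l ≠ s :: l') :
    child (insert (l, Δ) S) s = S.child s := by
  ext ⟨l', Γ⟩
  simp only [child, Set.mem_insert_iff, Set.mem_ofPred_eq, Prod.mk.injEq, (h l').symm, false_and,
    false_or]

theorem child_singleton_nil : child {([], Δ)} s = {([], s)} := by
  ext ⟨l, Γ⟩
  simp [child]

theorem subtree_append (S : Labelling α) (l l' : List (NSeq α)) :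
    S.subtree (l ++ l') = (S.subtree l).subtree l' :=
  List.foldl_append

theorem mem_label_of_mem (h : (l, Γ) ∈ S) : Γ ∈ S.label l := by
  induction l generalizing S with
  | nil => exact h
  | cons s l ih => exact ih (S := S.child s) (.inr h)

theorem mem_label_append_singleton (S : Labelling α) (l : List (NSeq α)) (s : NSeq α) :
    s ∈ S.label (l ++ [s]) := by
  rw [label, subtree_append]
  exact .inl rfl

theorem IsNode.mono (h : S ⊆ T) (hl : S.IsNode l) : T.IsNode l := by
  induction l generalizing S T with
  | nil => trivial
  | cons s l ih => exact ⟨h hl.1, ih (child_mono h s) hl.2⟩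

theorem isNode_append {l' : List (NSeq α)} :
    S.IsNode (l ++ l') ↔ S.IsNode l ∧ (S.subtree l).IsNode l' := by
  induction l generalizing S with
  | nil => exact (iff_of_eq (true_and _)).symm
  | cons s l ih => exact (and_congr_right' ih).trans and_assoc.symm

theorem isNode_append_singleton (hl : S.IsNode l) (hs : brk s ∈ S.label l) :
    S.IsNode (l ++ [s]) :=
  isNode_append.2 ⟨hl, hs, trivial⟩

theorem Rooted.child (hS : S.Rooted) (s : NSeq α) : (S.child s).Rooted := by
  rintro i (rfl | hi)
  · trivial
  · exact (hS _ hi).2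

theorem Rooted.child_eq_singleton (hS : S.Rooted) (hs : ([], brk s) ∉ S) :
    S.child s = {([], s)} := by
  refine (congrArg _ (Set.eq_empty_of_forall_notMem fun i hi => hs ?_)).trans
    (insert_empty_eq _)
  exact (hS _ hi).1

/-- The sequents that approximate the labelled tree from below: finite sums of sequents in the label
of the root and of bracketed approximations of the subtrees at the children of the root. -/
inductive Approx : Labelling α → NSeq α → Prop
  | zero (S : Labelling α) : Approx S 0
  | mem {S : Labelling α} {Γ : NSeq α} : ([], Γ) ∈ S → Approx S Γ
  | add {S : Labelling α} {Γ Δ : NSeq α} : Approx S Γ → Approx S Δ → Approx S (Γ + Δ)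
  | brk {S : Labelling α} {s Γ : NSeq α} :
      ([], .brk s) ∈ S → Approx (S.child s) Γ → Approx S (.brk Γ)

/-- The approximations of a labelled tree with a hole at the node `l`. -/
inductive ApproxAt : Labelling α → List (NSeq α) → Context α → Prop
  | hole {S : Labelling α} {Γ : NSeq α} : Approx S Γ → ApproxAt S [] (.hole Γ)
  | brk {S : Labelling α} {s Γ : NSeq α} {l : List (NSeq α)} {C : Context α} :
      ([], .brk s) ∈ S → Approx S Γ → ApproxAt (S.child s) l C → ApproxAt S (s :: l) (.brk Γ C)

theorem Approx.mono (h : S ⊆ T) (hΓ : S.Approx Γ) : T.Approx Γ := by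
  induction hΓ generalizing T with
  | zero => exact .zero T
  | mem hm => exact .mem (h hm)
  | add _ _ ihΓ ihΔ => exact .add (ihΓ h) (ihΔ h)
  | brk hs _ ih => exact .brk (h hs) (ih (child_mono h _))

theorem Approx.exists_of_iUnion {ι : Type*} [Nonempty ι] {F : ι → Labelling α}
    (hF : Directed (· ⊆ ·) F) (h : Approx (⋃ i, F i) Γ) : ∃ i, (F i).Approx Γ := by
  generalize hS : ⋃ i, F i = S at h
  induction h generalizing F with
  | zero => exact ⟨Classical.arbitrary ι, .zero _⟩
  | mem hm =>
    subst hS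
    obtain ⟨i, hi⟩ := Set.mem_iUnion.1 hm
    exact ⟨i, .mem hi⟩
  | add _ _ ihΓ ihΔ =>
    obtain ⟨i, hi⟩ := ihΓ hF hS
    obtain ⟨j, hj⟩ := ihΔ hF hS
    obtain ⟨k, hik, hjk⟩ := hF i j
    exact ⟨k, .add (hi.mono hik) (hj.mono hjk)⟩
  | @brk _ s _ hs _ ih =>
    subst hS
    obtain ⟨i, hi⟩ := Set.mem_iUnion.1 hs
    have hchild : ⋃ i, (F i).child s = child (⋃ i, F i) s := by
      simp only [child, Set.insert_eq, ← Set.union_iUnion, Set.mem_iUnion, Set.ofPred_exists]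
    have hdir : Directed (· ⊆ ·) fun i => (F i).child s :=
      fun i j => (hF i j).imp fun _ h => ⟨child_mono h.1 s, child_mono h.2 s⟩
    obtain ⟨j, hj⟩ := ih hdir hchild
    obtain ⟨k, hik, hjk⟩ := hF i j
    exact ⟨k, .brk (hik hi) (hj.mono (child_mono hjk s))⟩

theorem Approx.le_of_singleton (h : Approx {([], Θ)} Γ) : Γ ≤ Θ := by
  generalize hS : ({([], Θ)} : Labelling α) = S at h
  induction h generalizing Θ with
  | zero => exact NSeq.zero_le Θ
  | mem hm =>
    subst hS
    exact (congrArg Prod.snd hm).le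
  | add _ _ ihΓ ihΔ => exact add_le_iff.2 ⟨ihΓ hS, ihΔ hS⟩
  | brk hs _ ih =>
    subst hS
    obtain rfl := congrArg Prod.snd hs
    exact brk_mono (ih child_singleton_nil.symm)

theorem ApproxAt.approx_fill (hC : S.ApproxAt l C) (hΘ : (S.subtree l).Approx Θ) :
    S.Approx (C.fill Θ) := by
  induction hC with
  | hole hΓ => exact .add hΓ hΘ
  | brk hs hΓ _ ih => exact .add hΓ (.brk hs (ih hΘ))

theorem IsNode.exists_approxAt (hl : S.IsNode l) (hΓ : S.Approx Γ) :
    ∃ C, S.ApproxAt l C ∧ ∀ Θ, Γ ≤ C.fill Θ := by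
  induction l generalizing S Γ with
  | nil => exact ⟨_, .hole hΓ, fun Θ => le_self_add Γ Θ⟩
  | cons s l ih =>
    obtain ⟨C, hC, -⟩ := ih hl.2 (.zero _)
    exact ⟨_, .brk hl.1 hΓ hC, fun Θ => le_self_add Γ _⟩

theorem ApproxAt.exists_ge {C' : Context α} (hC : S.ApproxAt l C) (hC' : S.ApproxAt l C') :
    ∃ D, S.ApproxAt l D ∧ ∀ Θ, C.fill Θ ≤ D.fill Θ ∧ C'.fill Θ ≤ D.fill Θ := by
  induction hC generalizing C' with
  | @hole _ Γ hΓ =>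
    obtain ⟨hΓ'⟩ := hC'
    refine ⟨_, .hole (hΓ.add hΓ'), fun Θ => ⟨?_, ?_⟩⟩
    · exact add_le_add_left (le_self_add _ _) Θ
    · exact add_le_add_left (le_add_self _ _) Θ
  | @brk _ _ Γ _ _ hs hΓ _ ih =>
    obtain _ | ⟨_, hΓ', hC'⟩ := hC'
    obtain ⟨D, hD, hle⟩ := ih hC'
    refine ⟨_, .brk hs (hΓ.add hΓ') hD, fun Θ => ⟨?_, ?_⟩⟩
    · exact add_le_add (le_self_add _ _) (brk_mono (hle Θ).1)
    · exact add_le_add (le_add_self _ _) (brk_mono (hle Θ).2)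

theorem ApproxAt.exists_nest (hC : S.ApproxAt l C) :
    ∃ Γ L, S.Approx Γ ∧ L.length = l.length ∧ S.Approx (nest L 0) ∧
      ∀ Θ, C.fill Θ = Γ + nest L Θ := by
  induction hC with
  | @hole S Γ hΓ => exact ⟨Γ, [], hΓ, rfl, .zero S, fun _ => rfl⟩
  | @brk _ _ Γ _ _ hs hΓ _ ih =>
    obtain ⟨Γ', L, hΓ', hlen, hL, hfill⟩ := ih
    refine ⟨Γ, Γ' :: L, hΓ, congrArg (· + 1) hlen, .brk hs (hΓ'.add hL), fun Θ => ?_⟩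
    rw [Context.fill, hfill, nest]

theorem ApproxAt.exists_fill_nest_of_append {l' : List (NSeq α)} (hC : S.ApproxAt (l ++ l') C) :
    ∃ D L, S.ApproxAt l D ∧ L.length = l'.length ∧ (S.subtree l).Approx (nest L 0) ∧
      ∀ Θ, C.fill Θ = D.fill (nest L Θ) := by
  induction l generalizing S C with
  | nil =>
    obtain ⟨Γ, L, hΓ, hL⟩ := hC.exists_nest
    exact ⟨.hole Γ, L, .hole hΓ, hL⟩
  | cons s l ih =>
    obtain _ | ⟨hs, hΓ, hC⟩ := hC
    obtain ⟨D, L, hD, hlen, hL, hfill⟩ := ih hC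
    refine ⟨_, L, .brk hs hΓ hD, hlen, hL, fun Θ => ?_⟩
    rw [Context.fill, hfill, Context.fill]

theorem Approx.exists_le_add_of_insert_nil (hS : S.Rooted) (hΔ : ([], Δ) ∉ S)
    (h : Approx (insert ([], Δ) S) Γ) : ∃ Θ, S.Approx Θ ∧ Γ ≤ Θ + Δ := by
  generalize hT : insert ([], Δ) S = T at h
  induction h with
  | zero => exact ⟨0, .zero S, NSeq.zero_le _⟩
  | @mem _ Γ hm =>
    subst hT
    rcases hm with h | h
    · exact ⟨0, .zero S, (congrArg Prod.snd h).trans_le (le_add_self Δ 0)⟩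
    · exact ⟨Γ, .mem h, le_self_add Γ Δ⟩
  | add _ _ ihΓ ihΓ' =>
    obtain ⟨Θ, hΘ, hle⟩ := ihΓ hT
    obtain ⟨Θ', hΘ', hle'⟩ := ihΓ' hT
    refine ⟨Θ + Θ', hΘ.add hΘ', add_le_iff.2 ⟨hle.trans ?_, hle'.trans ?_⟩⟩
    · exact add_le_add_left (le_self_add Θ Θ') Δ
    · exact add_le_add_left (le_add_self Θ' Θ) Δ
  | @brk _ s Γ hs hΓ _ =>
    subst hT
    rw [child_insert_of_forall_ne (l := []) nofun] at hΓ
    rcases hs with hs | hs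
    · obtain rfl : NSeq.brk s = Δ := congrArg Prod.snd hs
      rw [hS.child_eq_singleton hΔ] at hΓ
      exact ⟨0, .zero S, (brk_mono hΓ.le_of_singleton).trans (le_add_self _ 0)⟩
    · exact ⟨.brk Γ, .brk hs hΓ, le_self_add _ Δ⟩

theorem Approx.exists_le_fill_of_insert (hS : S.Rooted) (hl : S.IsNode l) (hΔ : Δ ∉ S.label l)
    (h : Approx (insert (l, Δ) S) Γ) : ∃ C, S.ApproxAt l C ∧ Γ ≤ C.fill Δ := by
  induction l generalizing S Γ with
  | nil =>
    obtain ⟨Θ, hΘ, hle⟩ := h.exists_le_add_of_insert_nil hS hΔ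
    exact ⟨.hole Θ, .hole hΘ, hle⟩
  | cons t l ih =>
    have of_approx : ∀ {Γ}, S.Approx Γ → ∃ C, S.ApproxAt (t :: l) C ∧ Γ ≤ C.fill Δ := fun hΓ =>
      (hl.exists_approxAt hΓ).imp fun _ hC => ⟨hC.1, hC.2 Δ⟩
    generalize hT : insert (t :: l, Δ) S = T at h
    induction h with
    | zero => exact of_approx (.zero S)
    | mem hm =>
      subst hT
      exact of_approx (.mem (hm.resolve_left nofun))
    | add _ _ ihΓ ihΓ' =>
      obtain ⟨C, hC, hle⟩ := ihΓ hT
      obtain ⟨C', hC', hle'⟩ := ihΓ' hT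
      obtain ⟨D, hD, hCD⟩ := hC.exists_ge hC'
      exact ⟨D, hD, add_le_iff.2 ⟨hle.trans (hCD Δ).1, hle'.trans (hCD Δ).2⟩⟩
    | @brk _ s Γ hs hΓ _ =>
      subst hT
      rcases eq_or_ne t s with rfl | hts
      · rw [child_insert_cons_self] at hΓ
        obtain ⟨C, hC, hle⟩ := ih (hS.child t) hl.2 hΔ hΓ
        exact ⟨_, .brk hl.1 (.zero S) hC, (brk_mono hle).trans (le_add_self _ 0)⟩
      · rw [child_insert_of_forall_ne fun _ h => hts (List.cons.inj h).1] at hΓ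
        exact of_approx (.brk (hs.resolve_left nofun) hΓ)

end Labelling

/-! ### Maximal consistent labelled trees -/

section Completeness

variable {Y : Set ℕ} {A B : Formula α} {S : Labelling α} {l : List (NSeq α)} {Γ Δ Θ : NSeq α}

namespace Labelling

open NSeq

/-- A labelled tree that is not refuted by a finite part of it. -/
structure Consistent (Y : Set ℕ) (S : Labelling α) : Prop where
  rooted : S.Rooted
  not_provable {Γ : NSeq α} : S.Approx Γ → ¬Provable (nK ⊔ diaK Y) Γ

theorem consistent_singleton (h : ¬Provable (nK ⊔ diaK Y) Γ) : Consistent Y {([], Γ)} where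
  rooted := by
    rintro _ rfl
    trivial
  not_provable hΔ hprov := h (hprov.of_le hΔ.le_of_singleton)

theorem Consistent.exists_maximal (hS : S.Consistent Y) :
    ∃ T, S ⊆ T ∧ Maximal (Consistent Y) T := by
  refine zorn_subset_nonempty {T | Consistent Y T} (fun c hc hchain hne => ?_) S hS
  refine ⟨⋃₀ c, ⟨?_, fun hΓ => ?_⟩, fun T => Set.subset_sUnion_of_mem⟩
  · rintro i ⟨T, hT, hi⟩
    exact ((hc hT).rooted i hi).mono (Set.subset_sUnion_of_mem hT)
  · have : Nonempty c := hne.to_subtype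
    rw [Set.sUnion_eq_iUnion] at hΓ
    obtain ⟨T, hT⟩ := hΓ.exists_of_iUnion hchain.directed
    exact (hc T.2).not_provable hT

theorem Consistent.not_provable_fill (hS : S.Consistent Y) {C : Context α} (hC : S.ApproxAt l C)
    (hΓ : Γ ∈ S.label l) : ¬Provable (nK ⊔ diaK Y) (C.fill Γ) :=
  hS.not_provable (hC.approx_fill (.mem hΓ))

theorem Consistent.natom_notMem_label (hS : S.Consistent Y) (hl : S.IsNode l) {p : α}
    (hp : fml (.atom p) ∈ S.label l) : fml (.natom p) ∉ S.label l := by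
  intro hn
  obtain ⟨C, hC, -⟩ := hl.exists_approxAt (.zero S)
  exact hS.not_provable (hC.approx_fill (.add (.mem hp) (.mem hn))) (.fill_of_atom_le le_rfl)

theorem exists_provable_fill (hS : Maximal (Consistent Y) S) (hl : S.IsNode l)
    (hΔ : Δ ∉ S.label l) : ∃ C, S.ApproxAt l C ∧ Provable (nK ⊔ diaK Y) (C.fill Δ) := by
  have hsub : S ⊆ insert (l, Δ) S := Set.subset_insert _ _
  have hrooted : Rooted (insert (l, Δ) S) := by
    rintro i (rfl | hi)
    · exact hl.mono hsub
    · exact (hS.prop.rooted i hi).mono hsub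
  by_contra! h
  have hcons : Consistent Y (insert (l, Δ) S) := by
    refine ⟨hrooted, fun hΓ hprov => ?_⟩
    obtain ⟨C, hC, hle⟩ := hΓ.exists_le_fill_of_insert hS.prop.rooted hl hΔ
    exact h C hC (hprov.of_le hle)
  exact hΔ (mem_label_of_mem (hS.le_of_ge hcons hsub (Set.mem_insert _ _)))

theorem mem_label_of_rule (hS : Maximal (Consistent Y) S) (hl : S.IsNode l) (hΓ : Γ ∈ S.label l)
    (hrule : ∀ C : Context α, Provable (nK ⊔ diaK Y) (C.fill Δ) →
      Provable (nK ⊔ diaK Y) (C.fill Γ)) : Δ ∈ S.label l := by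
  by_contra hΔ
  obtain ⟨C, hC, hprov⟩ := exists_provable_fill hS hl hΔ
  exact hS.prop.not_provable_fill hC hΓ (hrule C hprov)

theorem mem_label_of_le (hS : Maximal (Consistent Y) S) (hl : S.IsNode l) (hΓ : Γ ∈ S.label l)
    (hle : Δ ≤ Γ) : Δ ∈ S.label l :=
  mem_label_of_rule hS hl hΓ fun C h => h.of_le (C.fill_mono hle)

theorem mem_label_or_of_and (hS : Maximal (Consistent Y) S) (hl : S.IsNode l)
    (h : fml (.and A B) ∈ S.label l) : fml A ∈ S.label l ∨ fml B ∈ S.label l := by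
  by_contra! hAB
  obtain ⟨C, hC, hA⟩ := exists_provable_fill hS hl hAB.1
  obtain ⟨C', hC', hB⟩ := exists_provable_fill hS hl hAB.2
  obtain ⟨D, hD, hle⟩ := hC.exists_ge hC'
  exact hS.prop.not_provable_fill hD h
    (.and_rule (hA.of_le (hle _).1) (hB.of_le (hle _).2))

theorem mem_label_append_of_dia (hS : Maximal (Consistent Y) S) {L : List (NSeq α)}
    (hL : L.length ∈ insert 1 Y) (hl : S.IsNode (l ++ L)) (h : fml (.dia A) ∈ S.label l) :
    fml A ∈ S.label (l ++ L) := by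
  by_contra hA
  obtain ⟨C, hC, hprov⟩ := exists_provable_fill hS hl hA
  obtain ⟨D, L', hD, hlen, hL', hfill⟩ := hC.exists_fill_nest_of_append
  rw [hfill] at hprov
  have hprem : Provable (nK ⊔ diaK Y) (D.fill (fml (.dia A) + nest L' (fml A))) :=
    hprov.of_le (D.fill_mono (le_add_self _ _))
  exact hS.prop.not_provable (hD.approx_fill (.add (.mem h) hL')) (.dia_rule (hlen ▸ hL) hprem)

/-- The model on the nodes of `S` in which, for maximal consistent `S`, each sequent fails at the
nodes that it labels. -/
def canonicalModel (Y : Set ℕ) (S : Labelling α) : Model α {l // S.IsNode l} where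
  rel l l' := ∃ L, l'.1 = l.1 ++ L ∧ L.length ∈ insert 1 Y
  val l p := fml (.atom p) ∉ S.label l.1

theorem exists_eq_append_of_reach
    (hY : ∀ m ∈ insert 1 Y, ∀ n ∈ insert 1 Y, m + n - 1 ∈ insert 1 Y) {k : ℕ}
    {l l' : {l // S.IsNode l}} (h : (canonicalModel Y S).Reach k l l') :
    ∃ L, l'.1 = l.1 ++ L ∧ ∀ n, n + k ∈ insert 1 Y → n + L.length ∈ insert 1 Y := by
  induction k generalizing l with
  | zero => exact ⟨[], by rw [List.append_nil, h], fun _ hn => hn⟩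
  | succ k ih =>
    obtain ⟨m, ⟨L, hm, hL⟩, hreach⟩ := h
    obtain ⟨L', hl', hL'⟩ := ih hreach
    refine ⟨L ++ L', by rw [hl', hm, List.append_assoc], fun n hn => ?_⟩
    have hnk : n + L.length + k ∈ insert 1 Y := by
      convert hY _ hn _ hL using 1
      lia
    rw [List.length_append, ← add_assoc]
    exact hL' _ hnk

theorem rel_of_reach (hY : ∀ m ∈ Y, ∀ n ∈ Y, m + n - 1 ∈ Y) {k : ℕ} (hk : k ∈ Y)
    {l l' : {l // S.IsNode l}} (h : (canonicalModel Y S).Reach k l l') :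
    (canonicalModel Y S).rel l l' := by
  have hinsert : ∀ m ∈ insert 1 Y, ∀ n ∈ insert 1 Y, m + n - 1 ∈ insert 1 Y := by
    rintro m (rfl | hm) n (rfl | hn)
    · exact .inl rfl
    · exact .inr (by rwa [Nat.add_sub_cancel_left])
    · exact .inr (by rwa [Nat.add_sub_cancel])
    · exact .inr (hY m hm n hn)
  obtain ⟨L, hl', hL⟩ := exists_eq_append_of_reach hinsert h
  refine ⟨L, hl', ?_⟩
  simpa only [zero_add] using hL 0 (.inr (by rwa [zero_add]))

theorem not_sat_of_fml_mem_label (hS : Maximal (Consistent Y) S) (l : {l // S.IsNode l})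
    (h : fml A ∈ S.label l.1) : ¬A.Sat (canonicalModel Y S) l := by
  induction A generalizing l with
  | atom p => exact not_not.2 h
  | natom p => exact not_not.2 fun hp => hS.prop.natom_notMem_label l.2 hp h
  | and A B ihA ihB =>
    rintro ⟨hA, hB⟩
    exact (mem_label_or_of_and hS l.2 h).elim (ihA l · hA) (ihB l · hB)
  | or A B ihA ihB =>
    have hAB := mem_label_of_rule hS l.2 h fun C hprov => hprov.or_rule
    rintro (hA | hB)
    · exact ihA l (mem_label_of_le hS l.2 hAB (le_self_add _ _)) hA
    · exact ihB l (mem_label_of_le hS l.2 hAB (le_add_self _ _)) hB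
  | box A ih =>
    have hA := mem_label_of_rule hS l.2 h fun C hprov => hprov.box_rule
    exact fun hsat => ih ⟨_, isNode_append_singleton l.2 hA⟩ (mem_label_append_singleton S _ _)
      (hsat _ ⟨_, rfl, .inl rfl⟩)
  | dia A ih =>
    rintro ⟨⟨_, hl'⟩, ⟨L, rfl, hL⟩, hsat⟩
    exact ih _ (mem_label_append_of_dia hS hL hl' h) hsat

theorem not_sat_of_mem_label (hS : Maximal (Consistent Y) S) (l : {l // S.IsNode l})
    (h : Γ ∈ S.label l.1) : ¬Γ.Sat (canonicalModel Y S) l := by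
  induction Γ using NSeq.induction generalizing l with
  | zero => exact not_sat_zero
  | fml A => exact fun hsat => not_sat_of_fml_mem_label hS l h (sat_fml.1 hsat)
  | brk Δ ih =>
    exact fun hsat => ih ⟨_, isNode_append_singleton l.2 h⟩ (mem_label_append_singleton S _ Δ)
      (sat_brk.1 hsat _ ⟨_, rfl, .inl rfl⟩)
  | add Γ Δ ihΓ ihΔ =>
    intro hsat
    rcases sat_add.1 hsat with hsat | hsat
    · exact ihΓ l (mem_label_of_le hS l.2 h (le_self_add _ _)) hsat
    · exact ihΔ l (mem_label_of_le hS l.2 h (le_add_self _ _)) hsat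

end Labelling

end Completeness

theorem completionStage_mono (X : Set ℕ) : Monotone (completionStage X) :=
  monotone_nat_of_le_succ fun _ => Set.subset_union_left

theorem add_sub_one_mem_completion {X : Set ℕ} {m n : ℕ} (hm : m ∈ completion X)
    (hn : n ∈ completion X) : m + n - 1 ∈ completion X := by
  obtain ⟨p, hp⟩ := Set.mem_iUnion.1 hm
  obtain ⟨q, hq⟩ := Set.mem_iUnion.1 hn
  refine Set.mem_iUnion.2 ⟨max p q + 1, .inr ⟨m, ?_, n, ?_, rfl⟩⟩
  · exact completionStage_mono X (le_max_left p q) hp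
  · exact completionStage_mono X (le_max_right p q) hq

end NestedModal

open NestedModal in
theorem theorem2_general {α : Type*} {Y : Set ℕ} (hY : ∀ m ∈ Y, ∀ n ∈ Y, m + n - 1 ∈ Y)
    {Γ : NSeq α} (h : Provable (nK ⊔ diaK Y ⊔ cut) Γ) : Provable (nK ⊔ diaK Y) Γ := by
  by_contra hΓ
  obtain ⟨S, hsub, hS⟩ := (Labelling.consistent_singleton hΓ).exists_maximal
  have hroot : Γ ∈ S.label [] := hsub rfl
  exact Labelling.not_sat_of_mem_label hS ⟨[], trivial⟩ hroot
    (h.sat (fun _ hn _ _ => Labelling.rel_of_reach hY hn) _)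

theorem theorem2 {α : Type*} (X : Set ℕ) (hX : X ⊆ {n : ℕ | 1 < n})
    (Γ : NestedModal.NSeq α)
    (h : NestedModal.Provable
      (NestedModal.nK ⊔ NestedModal.diaK (NestedModal.completion X) ⊔ NestedModal.cut) Γ) :
    NestedModal.Provable
      (NestedModal.nK ⊔ NestedModal.diaK (NestedModal.completion X)) Γ :=
  theorem2_general (fun _ hm _ hn => NestedModal.add_sub_one_mem_completion hm hn) h
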